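/- Let $q\ge 0$ be an integer. For $w\in(\mathbb{R}^q)^{\mathbb{Z}}$ (a map $\mathbb{Z}\to\mathbb{R}^q$, called a trajectory) and $\tau\in\mathbb{Z}$ let $(\sigma^\tau w)(t)=w(t+\tau)$; $w$ is constant if $\sigma^\tau w=w$ for all $\tau\in\mathbb{Z}$. For integers $t_0\le t_1$ let $w_{[t_0,t_1]}$ be the restriction of $w$ to $\{t_0,\dots,t_1\}$, and for $\mathcal{B}\subseteq(\mathbb{R}^q)^{\mathbb{Z}}$ let $\mathcal{B}_{[t_0,t_1]}=\{w_{[t_0,t_1]}: w\in\mathcal{B}\}$. An affine behavior is a nonempty set $\mathcal{B}\subseteq(\mathbb{R}^q)^{\mathbb{Z}}$ that is time-invariant ($w\in\mathcal{B}$ implies $\sigma^\tau w\in\mathcal{B}$ for all $\tau\in\mathbb{Z}$), complete (there is an integer $L\ge 0$ such that every $w\in(\mathbb{R}^q)^{\mathbb{Z}}$ with $w_{[t,t+L]}\in\mathcal{B}_{[t,t+L]}$ for all $t\in\mathbb{Z}$ belongs to $\mathcal{B}$), and affine ($\alpha w_1+(1-\alpha)w_2\in\mathcal{B}$ for all $w_1,w_2\in\mathcal{B}$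 and $\alpha\in\mathbb{R}$). Its difference behavior is $\operatorname{dif}(\mathcal{B})=\mathcal{B}-\mathcal{B}=\{w_1-w_2: w_1,w_2\in\mathcal{B}\}$. For a constant trajectory $\bar w$, a set $\mathcal{B}$ of trajectories is called $\bar w$-stabilizable if for every $w\in\mathcal{B}$ there is a $\tilde w\in\mathcal{B}$ such that $w(t)=\tilde w(t)$ for all $t\le 0$ and $\lim_{t\to\infty}\tilde w(t)=\bar w$ (identifying $\bar w$ with its value in $\mathbb{R}^q$). It is called offset stabilizable if there is a constant trajectory $\bar w\in\mathcal{B}$ such that $\mathcal{B}$ is $\bar w$-stabilizable. Let $\mathcal{B}\subseteq(\mathbb{R}^q)^{\mathbb{Z}}$ be an affine behavior. Then $\mathcal{B}$ is offset stabilizable if and only if $\operatorname{dif}(\mathcal{B})$ is $0$-stabilizable. -/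

import Mathlib

open scoped Pointwise

namespace AffineBehavior

/-- The space `(ℝ^q)^ℤ` of all maps from `ℤ` to `ℝ^q`. -/
abbrev Trajectory (q : ℕ) : Type := ℤ → Fin q → ℝ

variable {q : ℕ}

/-- The shift `(σ^τ w)(t) = w(t + τ)`. -/
def shift (τ : ℤ) (w : Trajectory q) : Trajectory q := fun t => w (t + τ)

/-- A trajectory is constant if every shift leaves it unchanged. -/
def IsConstant (w : Trajectory q) : Prop := ∀ τ : ℤ, shift τ w = w

/-- A set of trajectories is time-invariant if it is closed under all shifts. -/
def IsTimeInvariant (B : Set (Trajectory q)) : Prop :=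
  ∀ w ∈ B, ∀ τ : ℤ, shift τ w ∈ B

/-- The restriction of a trajectory to the integer interval `[t₀, t₁]`. -/
def window (t₀ t₁ : ℤ) (w : Trajectory q) : Set.Icc t₀ t₁ → Fin q → ℝ :=
  fun s => w s

/-- `L`-completeness: a trajectory all of whose windows of length `L + 1` are windows of
elements of `B` (at the same times) belongs to `B`. -/
def IsLComplete (L : ℕ) (B : Set (Trajectory q)) : Prop :=
  ∀ w : Trajectory q,
    (∀ t : ℤ, window t (t + L) w ∈ window t (t + L) '' B) → w ∈ B

/-- Completeness: `L`-completeness for some nonnegative integer `L`. -/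
def IsComplete (B : Set (Trajectory q)) : Prop := ∃ L : ℕ, IsLComplete L B

/-- The model class of affine behaviors: nonempty, time-invariant, complete sets of trajectories
that are closed under affine combinations. -/
structure IsAffineBehavior (B : Set (Trajectory q)) : Prop where
  nonempty : B.Nonempty
  timeInvariant : IsTimeInvariant B
  complete : IsComplete B
  affine : ∀ w₁ ∈ B, ∀ w₂ ∈ B, ∀ α : ℝ, α • w₁ + (1 - α) • w₂ ∈ B

/-- The difference behavior `B - B` (Minkowski difference). -/
def dif (B : Set (Trajectory q)) : Set (Trajectory q) := B - B

/-- `B` is `wbar`-stabilizable, for a constant trajectory `wbar`: every `w ∈ B` agrees for all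
`t ≤ 0` with some element of `B` that converges, as `t → ∞`, to the value of `wbar`. -/
def IsStabilizableTo (B : Set (Trajectory q)) (wbar : Trajectory q) : Prop :=
  IsConstant wbar ∧
    ∀ w ∈ B, ∃ w' ∈ B, (∀ t : ℤ, t ≤ 0 → w t = w' t) ∧
      Filter.Tendsto w' Filter.atTop (nhds (wbar 0))

/-- `B` is offset stabilizable: it is `wbar`-stabilizable for some constant `wbar ∈ B`. -/
def IsOffsetStabilizable (B : Set (Trajectory q)) : Prop :=
  ∃ wbar ∈ B, IsConstant wbar ∧ IsStabilizableTo B wbar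

end AffineBehavior

namespace AffineBehavior

open Filter Topology

section

variable {q : ℕ} {B : Set (Trajectory q)}

/-! The crux is that a `0`-stabilizable `dif B` forces a constant trajectory into `B`. Stabilizing
the increments of some `w ∈ B` and summing them gives, by completeness, `v ∈ B` with increments
tending to zero. On a window of completeness length, deviations from the initial value form a
finite-dimensional, hence closed, affine image of `B`; so the limit `0` is attained, and
completeness extends that flat window to all of `ℤ`. The rest is translation by the constant. -/

theorem IsAffineBehavior.smul_sub_add_mem (hB : IsAffineBehavior B) (c : ℝ)
    {b₁ b₂ b : Trajectory q} (h₁ : b₁ ∈ B) (h₂ : b₂ ∈ B) (h : b ∈ B) :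
    c • (b₁ - b₂) + b ∈ B := by
  -- The target is the midpoint of `2c • b₁ + (1 - 2c) • b₂` and `2 • b - b₂`.
  have hx := hB.affine _ h₁ _ h₂ (2 * c)
  have hy := hB.affine _ h _ h₂ 2
  convert hB.affine _ hx _ hy (1 / 2) using 1
  module

theorem IsAffineBehavior.add_mem_of_mem_dif (hB : IsAffineBehavior B) {b d : Trajectory q}
    (hb : b ∈ B) (hd : d ∈ dif B) : b + d ∈ B := by
  obtain ⟨b₁, h₁, b₂, h₂, rfl⟩ := Set.mem_sub.1 hd
  simpa [add_comm] using hB.smul_sub_add_mem 1 h₁ h₂ hb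

/-- An affine behavior as an affine subspace of the space of trajectories. -/
def IsAffineBehavior.toAffineSubspace (hB : IsAffineBehavior B) :
    AffineSubspace ℝ (Trajectory q) where
  carrier := B
  smul_vsub_vadd_mem' := fun c _ _ _ h₁ h₂ h₃ => hB.smul_sub_add_mem c h₁ h₂ h₃

/-- A trajectory whose increments lie in `dif B` and whose past is that of an element of `B`
belongs to `B`. -/
theorem IsAffineBehavior.mem_of_increments_mem_dif (hB : IsAffineBehavior B)
    {v w d : Trajectory q} (hw : w ∈ B) (hd : d ∈ dif B) (hvw : ∀ t ≤ 0, v t = w t)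
    (hv : ∀ t, v (t + 1) = v t + d t) : v ∈ B := by
  obtain ⟨L, hL⟩ := hB.complete
  refine hL v fun t => ?_
  rcases le_total t (-(L : ℤ)) with ht | ht
  · exact ⟨w, hw, funext fun s => (hvw _ (by have := s.2.2; omega)).symm⟩
  · induction t, ht using Int.leInduction with
    | base => exact ⟨w, hw, funext fun s => (hvw _ (by have := s.2.2; omega)).symm⟩
    | succ t _ ih =>
      obtain ⟨b, hb, hbv⟩ := ih
      -- If `b` matches `v` on `[t, t + L]`, then `b + d` matches `v (· + 1)` there.
      refine ⟨shift (-1) (b + d), hB.timeInvariant _ (hB.add_mem_of_mem_dif hb hd) _,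
        funext fun s => ?_⟩
      have h₁ := s.2.1
      have h₂ := s.2.2
      have hs := congrFun hbv ⟨(s : ℤ) + -1, by omega, by omega⟩
      have hv' := hv ((s : ℤ) + -1)
      simp only [window] at hs
      simp only [window, shift, Pi.add_apply, hs]
      rw [← hv']
      congr 1
      omega

/-- If `dif B` is `0`-stabilizable, `B` has an element whose increments tend to zero. -/
theorem IsAffineBehavior.exists_increments_tendsto_zero (hB : IsAffineBehavior B)
    (h : IsStabilizableTo (dif B) 0) :
    ∃ v ∈ B, Tendsto (fun t => v (t + 1) - v t) atTop (𝓝 0) := by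
  obtain ⟨w, hw⟩ := hB.nonempty
  obtain ⟨d, hd, hdw, hlim⟩ := h.2 (shift 1 w - w) (Set.sub_mem_sub (hB.timeInvariant w hw 1) hw)
  -- For `t ≤ 0` the sum is empty; for `t ≥ 0` the first term stays at `w 0`.
  let v : Trajectory q := fun t => w (min t 0) + ∑ i ∈ Finset.range t.toNat, d i
  have hvw : ∀ t ≤ 0, v t = w t := fun t ht => by simp [v, ht, Int.toNat_of_nonpos ht]
  have hv : ∀ t, v (t + 1) = v t + d t := by
    intro t
    rcases lt_or_ge t 0 with ht | ht
    · rw [hvw _ (by omega), hvw _ ht.le, ← hdw t ht.le]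
      simp [shift]
    · lift t to ℕ using ht
      have h₁ : min ((t : ℤ) + 1) 0 = 0 := by omega
      have h₂ : min (t : ℤ) 0 = 0 := by omega
      have h₃ : ((t : ℤ) + 1).toNat = t + 1 := by omega
      simp only [v, h₁, h₂, h₃, Int.toNat_natCast, Finset.sum_range_succ, add_assoc]
  refine ⟨v, hB.mem_of_increments_mem_dif hw hd hvw hv, ?_⟩
  simpa [hv] using hlim

theorem tendsto_add_natCast_sub_zero {v : Trajectory q}
    (hv : Tendsto (fun t => v (t + 1) - v t) atTop (𝓝 0)) (k : ℕ) :
    Tendsto (fun t => v (t + k) - v t) atTop (𝓝 0) := by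
  induction k with
  | zero => simp
  | succ k ih =>
    have := (hv.comp (tendsto_atTop_add_const_right atTop (k : ℤ) tendsto_id)).add ih
    simpa [Function.comp_def, add_assoc] using this

/-- The linear map sending a trajectory to its deviations from its value at time `0` on the
window `[0, L]`. -/
def windowDeviation (q L : ℕ) :
    Trajectory q →ₗ[ℝ] (Set.Icc (0 : ℤ) L → Fin q → ℝ) where
  toFun w := fun s => w s - w 0
  map_add' _ _ := by ext; simp; ring
  map_smul' _ _ := by ext; simp; ring

/-- If `B` contains trajectories with arbitrarily small increments, it contains a constant one:
an affine subspace of a finite-dimensional space is closed. -/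
theorem IsAffineBehavior.exists_isConstant_mem (hB : IsAffineBehavior B) {v : Trajectory q}
    (hvB : v ∈ B) (hv : Tendsto (fun t => v (t + 1) - v t) atTop (𝓝 0)) :
    ∃ c ∈ B, IsConstant c := by
  obtain ⟨L, hL⟩ := hB.complete
  let A := hB.toAffineSubspace.map (windowDeviation q L).toAffineMap
  have hA : IsClosed (A : Set (Set.Icc (0 : ℤ) L → Fin q → ℝ)) :=
    A.closed_of_finiteDimensional
  have hlim : Tendsto (fun t => windowDeviation q L (shift t v)) atTop (𝓝 0) := by
    refine tendsto_pi_nhds.2 fun ⟨s, hs⟩ => ?_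
    obtain ⟨k, rfl⟩ := Int.eq_ofNat_of_zero_le hs.1
    simpa [windowDeviation, shift, add_comm] using tendsto_add_natCast_sub_zero hv k
  -- This `w ∈ B` is constant on `[0, L]`; its shifts supply every window of the constant `w 0`.
  obtain ⟨w, hw, hw0⟩ : (0 : Set.Icc (0 : ℤ) L → Fin q → ℝ) ∈ A :=
    hA.mem_of_tendsto hlim (.of_forall fun t => ⟨_, hB.timeInvariant v hvB t, rfl⟩)
  refine ⟨fun _ => w 0, hL _ fun t => ?_, fun _ => rfl⟩
  refine ⟨shift (-t) w, hB.timeInvariant w hw _, funext fun s => ?_⟩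
  have h₁ := s.2.1
  have h₂ := s.2.2
  exact sub_eq_zero.1 (congrFun hw0 ⟨(s : ℤ) + -t, by omega, by omega⟩)

theorem IsStabilizableTo.dif_zero {c : Trajectory q} (h : IsStabilizableTo B c) :
    IsStabilizableTo (dif B) 0 := by
  refine ⟨fun _ => rfl, fun d hd => ?_⟩
  obtain ⟨b₁, h₁, b₂, h₂, rfl⟩ := Set.mem_sub.1 hd
  obtain ⟨b₁', h₁', e₁, l₁⟩ := h.2 b₁ h₁
  obtain ⟨b₂', h₂', e₂, l₂⟩ := h.2 b₂ h₂
  refine ⟨b₁' - b₂', Set.sub_mem_sub h₁' h₂', fun t ht => ?_, ?_⟩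
  · simp [e₁ t ht, e₂ t ht]
  · have := l₁.sub l₂
    rwa [sub_self] at this

theorem IsAffineBehavior.isStabilizableTo_of_dif (hB : IsAffineBehavior B) {c : Trajectory q}
    (hc : c ∈ B) (hconst : IsConstant c) (h : IsStabilizableTo (dif B) 0) :
    IsStabilizableTo B c := by
  refine ⟨hconst, fun w hw => ?_⟩
  obtain ⟨d, hd, e, l⟩ := h.2 (w - c) (Set.sub_mem_sub hw hc)
  have hc0 : c = fun _ => c 0 := funext fun t => by
    simpa [shift] using congrFun (hconst t) 0
  refine ⟨c + d, hB.add_mem_of_mem_dif hc hd, fun t ht => ?_, ?_⟩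
  · simp [← e t ht]
  · have hclim : Tendsto c atTop (𝓝 (c 0)) :=
      tendsto_const_nhds.congr fun t => (congrFun hc0 t).symm
    have := hclim.add l
    rwa [Pi.zero_apply, add_zero] at this

end

end AffineBehavior

theorem lemma4 (q : ℕ) (B : Set (AffineBehavior.Trajectory q))
    (hB : AffineBehavior.IsAffineBehavior B) :
    AffineBehavior.IsOffsetStabilizable B ↔
      AffineBehavior.IsStabilizableTo (AffineBehavior.dif B) 0 := by
  constructor
  · rintro ⟨c, -, -, h⟩
    exact h.dif_zero
  · intro h
    obtain ⟨v, hvB, hv⟩ := hB.exists_increments_tendsto_zero h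
    obtain ⟨c, hc, hconst⟩ := hB.exists_isConstant_mem hvB hv
    exact ⟨c, hc, hconst, hB.isStabilizableTo_of_dif hc hconst h⟩
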